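/- Let $\mathbb S^3\subset\mathbb R^4$ be the unit sphere and let $\mathrm{Harm}_\ell(\mathbb R^4)$ be the space of real polynomials in four variables that are homogeneous of degree $\ell$ and annihilated by the Laplacian. For a set $T$ of positive integers, a non-empty finite set $X\subset\mathbb S^3$ is a spherical $T$-design if $\sum_{x\in X}P(x)=0$ for all $\ell\in T$ and all $P\in\mathrm{Harm}_\ell(\mathbb R^4)$; it is antipodal if $-X=X$. Write $A(X)=\{\langle x,y\rangle : x,y\in X,\ x\neq y\}$ and $\tau=(1+\sqrt5)/2$. An antipodal spherical $T$-design of $\mathbb S^3$ is called minimal if $|X|=24$ when $T=\{10,4,2\}$, if $|X|=48$ when $T=\{14,10,6,4,2\}$, and if $|X|=120$ when $T=\{10,8,6,4,2\}$. Then: (i) An antipodal spherical $\{10,4,2\}$-design $X$ of $\mathbb S^3$ is minimal (that is, $|X|=24$) if and only if $A(X)\subset\{-1,\pm\frac12,0\}$. (ii) An antipodal spherical $\{14,10,6,4,2\}$-design $X$ of $\mathbb S^3$ is minimal (that is, $|X|=48$) if and only if $A(X)\subset\{-1,\pm\frac1{\sqrt2},\pm\frac12,0\}$. (iii) An antipodal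 spherical $\{10,8,6,4,2\}$-design $X$ of $\mathbb S^3$ is minimal (that is, $|X|=120$) if and only if $A(X)\subset\{-1,\pm\frac{\tau^{-1}}2,\pm\frac{\tau}2,\pm\frac12,0\}$. -/

import Mathlib

open scoped RealInnerProductSpace

namespace SphericalDesign

/-- The Laplacian `∑ a, ∂²P/∂x_a²` on real polynomials in `d` variables. -/
noncomputable def laplacian (d : ℕ) :
    MvPolynomial (Fin d) ℝ →ₗ[ℝ] MvPolynomial (Fin d) ℝ :=
  ∑ a : Fin d, (MvPolynomial.pderiv a).toLinearMap ∘ₗ (MvPolynomial.pderiv a).toLinearMap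

/-- `Harm_ℓ(ℝ^d)`: the harmonic polynomials in `d` variables, homogeneous of degree `ℓ`. -/
noncomputable def Harm (d ℓ : ℕ) : Submodule ℝ (MvPolynomial (Fin d) ℝ) :=
  MvPolynomial.homogeneousSubmodule (Fin d) ℝ ℓ ⊓ LinearMap.ker (laplacian d)

/-- The harmonic strength `T(X)`: all positive integers `ℓ` such that every harmonic polynomial,
homogeneous of degree `ℓ`, has sum `0` over `X`. -/
def harmonicStrength {d : ℕ} (X : Finset (EuclideanSpace ℝ (Fin d))) : Set ℕ :=
  {ℓ | 0 < ℓ ∧ ∀ P ∈ Harm d ℓ, ∑ x ∈ X, MvPolynomial.eval (fun a => x a) P = 0}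

/-- A spherical `T`-design of the unit sphere of `ℝ^d`: a non-empty finite set of unit vectors
whose harmonic strength contains `T`. -/
structure IsSphericalDesign {d : ℕ} (T : Set ℕ) (X : Finset (EuclideanSpace ℝ (Fin d))) :
    Prop where
  nonempty : X.Nonempty
  subset_sphere : (X : Set (EuclideanSpace ℝ (Fin d))) ⊆ Metric.sphere 0 1
  subset_harmonicStrength : T ⊆ harmonicStrength X

/-- `X` is antipodal: `-X = X`. -/
def IsAntipodal {d : ℕ} (X : Finset (EuclideanSpace ℝ (Fin d))) : Prop :=
  ∀ x ∈ X, -x ∈ X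

/-- `A(X)`: the set of inner products of two distinct points of `X`. -/
def innerProducts {d : ℕ} (X : Finset (EuclideanSpace ℝ (Fin d))) : Set ℝ :=
  {s | ∃ x ∈ X, ∃ y ∈ X, x ≠ y ∧ ⟪x, y⟫ = s}

end SphericalDesign

namespace SphericalDesign

open MvPolynomial

/-! This is Delsarte's linear programming method at equality. The zonal harmonics of
four-dimensional space are homogenized Chebyshev polynomials `U_n` of the second kind, so a
`T`-design satisfies `∑ x, U_n ⟪x, y⟫ = 0` for `n ∈ T` and every unit `y`. If `f` is a combination
of `U_0` and the `U_n` with `n ∈ T`, each row sum of `f` is `|X|` times its constant coefficient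
`c`. Splitting off `x = ±y` shows that vanishing of `f` at the remaining inner products forces `|X|
c = f 1 + f (-1)`; conversely, if `f ≥ 0` on `[-1, 1]`, that equality forces the vanishing.

For 24 and 48 points one `f` serves both directions. For 120 points the converse uses an `f` of
degree 16 with negative coefficients at `U_14` and `U_16`, outside `T`. These are controlled by
`sum_sum_chebU_nonneg`, since the Fischer product makes `U_n ⟪x, y⟫` a positive definite kernel. -/

/-- The Fischer (apolar) inner product `∑ m, m! * P_m * Q_m` on polynomials. -/
noncomputable def fischer {σ : Type*} [Fintype σ] :
    MvPolynomial σ ℝ →ₗ[ℝ] MvPolynomial σ ℝ →ₗ[ℝ] ℝ :=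
  (basisMonomials σ ℝ).constr ℝ fun m => (∏ a, ((m a).factorial : ℝ)) • lcoeff ℝ m

/-! ### The Fischer inner product. -/

section Fischer

variable {σ : Type*} [Fintype σ]

theorem fischer_monomial (m : σ →₀ ℕ) (c : ℝ) (Q : MvPolynomial σ ℝ) :
    fischer (monomial m c) Q = c * ((∏ a, ((m a).factorial : ℝ)) * coeff m Q) := by
  have h : (monomial m c : MvPolynomial σ ℝ) = c • basisMonomials σ ℝ m := by
    simp [smul_monomial]
  rw [h, map_smul, fischer, Module.Basis.constr_basis]
  simp

theorem fischer_self_nonneg (P : MvPolynomial σ ℝ) : 0 ≤ fischer P P := by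
  have h : fischer P P = ∑ m ∈ P.support, fischer (monomial m (coeff m P)) P := by
    conv_lhs => enter [1]; rw [P.as_sum]
    simp only [map_sum, LinearMap.sum_apply]
  rw [h]
  refine Finset.sum_nonneg fun m _ => ?_
  rw [fischer_monomial, mul_left_comm]
  exact mul_nonneg (Finset.prod_nonneg fun _ _ => Nat.cast_nonneg _) (mul_self_nonneg _)

/-- Multiplication by a variable is adjoint to differentiation because the weights satisfy `(k + 1)!
= (k + 1) * k!`. -/
theorem fischer_X_mul (a : σ) (P Q : MvPolynomial σ ℝ) :
    fischer (X a * P) Q = fischer P (pderiv a Q) := by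
  classical
  induction P using MvPolynomial.induction_on' with
  | add p q hp hq => simp [mul_add, hp, hq]
  | monomial m c =>
    rw [X, monomial_mul, one_mul, add_comm, fischer_monomial, fischer_monomial, coeff_pderiv]
    have h : (∏ b, (((m + Finsupp.single a 1 : σ →₀ ℕ) b).factorial : ℝ)) =
        (m a + 1) * ∏ b, ((m b).factorial : ℝ) := by
      rw [← Finset.mul_prod_erase _ _ (Finset.mem_univ a),
        ← Finset.mul_prod_erase (s := Finset.univ) (fun b => ((m b).factorial : ℝ))
          (Finset.mem_univ a), ← mul_assoc]
      congr 1
      · simp [Nat.factorial_succ]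
      · refine Finset.prod_congr rfl fun b hb => ?_
        simp [(Finset.ne_of_mem_erase hb).symm]
    rw [h]
    ring

end Fischer

/-! ### Linear forms, the squared norm and the Laplacian. -/

section Zonal

variable {d : ℕ}

/-- The linear form `x ↦ ⟪y, x⟫` as a polynomial. -/
noncomputable def linForm (y : EuclideanSpace ℝ (Fin d)) : MvPolynomial (Fin d) ℝ :=
  ∑ a, C (y a) * X a

/-- The polynomial `‖x‖ ^ 2`. -/
noncomputable def normSqPoly (d : ℕ) : MvPolynomial (Fin d) ℝ :=
  ∑ a, X a * X a

/-- The derivative in direction `y`. -/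
noncomputable def dirDeriv (y : EuclideanSpace ℝ (Fin d)) :
    Derivation ℝ (MvPolynomial (Fin d) ℝ) (MvPolynomial (Fin d) ℝ) :=
  ∑ a, y a • pderiv a

theorem dirDeriv_apply (y : EuclideanSpace ℝ (Fin d)) (P : MvPolynomial (Fin d) ℝ) :
    dirDeriv y P = ∑ a, C (y a) * pderiv a P := by
  rw [dirDeriv, ← Derivation.coeFnAddMonoidHom_apply, map_sum, Finset.sum_apply]
  simp [C_mul', Derivation.coeFnAddMonoidHom_apply]

theorem laplacian_apply (P : MvPolynomial (Fin d) ℝ) :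
    laplacian d P = ∑ a, pderiv a (pderiv a P) := by
  simp [laplacian, LinearMap.sum_apply]

theorem pderiv_linForm (y : EuclideanSpace ℝ (Fin d)) (a : Fin d) :
    pderiv a (linForm y) = C (y a) := by
  classical
  simp [linForm, pderiv_X, Pi.single_apply]

theorem pderiv_normSqPoly (a : Fin d) :
    pderiv a (normSqPoly d) = 2 * X a := by
  classical
  simp only [normSqPoly, map_sum, pderiv_mul, pderiv_X, Pi.single_apply, ite_mul, mul_ite,
    one_mul, mul_one, zero_mul, mul_zero, Finset.sum_add_distrib,
    Finset.sum_ite_eq', Finset.mem_univ, if_true]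
  ring

theorem isHomogeneous_linForm (y : EuclideanSpace ℝ (Fin d)) : (linForm y).IsHomogeneous 1 :=
  IsHomogeneous.sum _ _ _ fun a _ => by
    simpa using (isHomogeneous_C _ (y a)).mul (isHomogeneous_X ℝ a)

theorem isHomogeneous_normSqPoly : (normSqPoly d).IsHomogeneous 2 :=
  IsHomogeneous.sum _ _ _ fun a _ => (isHomogeneous_X ℝ a).mul (isHomogeneous_X ℝ a)

theorem eval_linForm (x y : EuclideanSpace ℝ (Fin d)) :
    eval (fun a => x a) (linForm y) = ⟪x, y⟫ := by
  simp [linForm, PiLp.inner_apply]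

theorem eval_normSqPoly (x : EuclideanSpace ℝ (Fin d)) :
    eval (fun a => x a) (normSqPoly d) = ⟪x, x⟫ := by
  simp [normSqPoly, PiLp.inner_apply, -inner_self_eq_norm_sq_to_K]

theorem inner_self_eq_one {y : EuclideanSpace ℝ (Fin d)} (hy : ‖y‖ = 1) : ⟪y, y⟫ = 1 := by
  rw [real_inner_self_eq_norm_sq, hy, one_pow]

theorem dirDeriv_linForm {y : EuclideanSpace ℝ (Fin d)} (hy : ‖y‖ = 1) :
    dirDeriv y (linForm y) = 1 := by
  have h := inner_self_eq_one hy
  rw [PiLp.inner_apply] at h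
  simp only [dirDeriv_apply, pderiv_linForm, ← C_mul, ← map_sum]
  rw [← C_1, ← h]
  simp [pow_two]

theorem dirDeriv_normSqPoly (y : EuclideanSpace ℝ (Fin d)) :
    dirDeriv y (normSqPoly d) = 2 * linForm y := by
  rw [dirDeriv_apply, linForm, Finset.mul_sum]
  exact Finset.sum_congr rfl fun a _ => by rw [pderiv_normSqPoly]; ring

theorem laplacian_linForm_mul (y : EuclideanSpace ℝ (Fin d)) (P : MvPolynomial (Fin d) ℝ) :
    laplacian d (linForm y * P) = linForm y * laplacian d P + 2 * dirDeriv y P := by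
  rw [laplacian_apply, laplacian_apply, dirDeriv_apply, Finset.mul_sum, Finset.mul_sum,
    ← Finset.sum_add_distrib]
  refine Finset.sum_congr rfl fun a _ => ?_
  simp only [pderiv_mul, pderiv_linForm, map_add, pderiv_C]
  ring

theorem laplacian_normSqPoly_mul {n : ℕ} {P : MvPolynomial (Fin d) ℝ} (hP : P.IsHomogeneous n) :
    laplacian d (normSqPoly d * P) =
      normSqPoly d * laplacian d P + (4 * n + 2 * d : ℕ) * P := by
  have h : laplacian d (normSqPoly d * P) =
      ∑ a, (normSqPoly d * pderiv a (pderiv a P) + 4 * (X a * pderiv a P) + 2 * P) := by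
    rw [laplacian_apply]
    refine Finset.sum_congr rfl fun a _ => ?_
    have h2 : pderiv a (2 : MvPolynomial (Fin d) ℝ) = 0 := (pderiv a).map_natCast 2
    simp only [pderiv_mul, pderiv_normSqPoly, map_add, pderiv_X_self, h2]
    ring
  rw [h, Finset.sum_add_distrib, Finset.sum_add_distrib, ← Finset.mul_sum, ← Finset.mul_sum,
    hP.sum_X_mul_pderiv, ← laplacian_apply]
  simp only [Finset.sum_const, Finset.card_univ, Fintype.card_fin, nsmul_eq_mul]
  push_cast
  ring

theorem fischer_normSqPoly_mul (P Q : MvPolynomial (Fin d) ℝ) :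
    fischer (normSqPoly d * P) Q = fischer P (laplacian d Q) := by
  simp only [normSqPoly, Finset.sum_mul, mul_assoc, map_sum, LinearMap.sum_apply, fischer_X_mul,
    laplacian_apply]

theorem fischer_linForm_mul (y : EuclideanSpace ℝ (Fin d)) (P Q : MvPolynomial (Fin d) ℝ) :
    fischer (linForm y * P) Q = fischer P (dirDeriv y Q) := by
  simp only [linForm, Finset.sum_mul, map_sum, LinearMap.sum_apply, dirDeriv_apply,
    C_mul', smul_mul_assoc, map_smul, LinearMap.smul_apply, fischer_X_mul]

theorem eval_dirDeriv {n : ℕ} {P : MvPolynomial (Fin d) ℝ} (hP : P.IsHomogeneous n)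
    (y : EuclideanSpace ℝ (Fin d)) :
    eval (fun a => y a) (dirDeriv y P) = n * eval (fun a => y a) P := by
  have h := congrArg (eval fun a => y a) hP.sum_X_mul_pderiv
  simpa [dirDeriv_apply] using h

theorem isHomogeneous_dirDeriv {n : ℕ} {P : MvPolynomial (Fin d) ℝ} (hP : P.IsHomogeneous n)
    (y : EuclideanSpace ℝ (Fin d)) : (dirDeriv y P).IsHomogeneous (n - 1) := by
  rw [dirDeriv_apply]
  exact IsHomogeneous.sum _ _ _ fun a _ => by
    simpa using (isHomogeneous_C _ (y a)).mul hP.pderiv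

/-- Reproducing property of powers of linear forms for the Fischer inner product. -/
theorem fischer_linForm_pow (y : EuclideanSpace ℝ (Fin d)) {n : ℕ}
    {P : MvPolynomial (Fin d) ℝ} (hP : P.IsHomogeneous n) :
    fischer (linForm y ^ n) P = n.factorial * eval (fun a => y a) P := by
  induction n generalizing P with
  | zero =>
    obtain ⟨c, rfl⟩ : ∃ c, P = C c :=
      ⟨_, totalDegree_eq_zero_iff_eq_C.1 ((totalDegree_zero_iff_isHomogeneous _).2 hP)⟩
    have h : (linForm y ^ 0 : MvPolynomial (Fin d) ℝ) = monomial 0 1 := by simp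
    rw [h, fischer_monomial]
    simp
  | succ n ih =>
    rw [pow_succ', fischer_linForm_mul, ih (isHomogeneous_dirDeriv hP y), eval_dirDeriv hP,
      Nat.factorial_succ]
    push_cast
    ring

end Zonal

/-- The zonal harmonic polynomial of degree `n` in four variables with pole `y`, built by the
recursion of the Chebyshev polynomials of the second kind. -/
noncomputable def zonal (y : EuclideanSpace ℝ (Fin 4)) : ℕ → MvPolynomial (Fin 4) ℝ
  | 0 => 1
  | 1 => 2 * linForm y
  | n + 2 => 2 * linForm y * zonal y (n + 1) - normSqPoly 4 * zonal y n

/-- The Chebyshev polynomials of the second kind, as functions on `ℝ`. -/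
noncomputable def chebU (t : ℝ) : ℕ → ℝ
  | 0 => 1
  | 1 => 2 * t
  | n + 2 => 2 * t * chebU t (n + 1) - chebU t n

/-! ### Zonal harmonics in dimension four and positive definiteness. -/

section ZonalFour

variable {x y : EuclideanSpace ℝ (Fin 4)}

theorem isHomogeneous_two_mul {n : ℕ} {P : MvPolynomial (Fin 4) ℝ} (h : P.IsHomogeneous n) :
    (2 * P).IsHomogeneous n := by
  have h2 := (isHomogeneous_C (Fin 4) (2 : ℝ)).mul h
  rwa [zero_add] at h2

theorem isHomogeneous_zonal (y : EuclideanSpace ℝ (Fin 4)) (n : ℕ) :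
    (zonal y n).IsHomogeneous n := by
  induction n using Nat.twoStepInduction with
  | zero => exact isHomogeneous_one _ _
  | one => exact isHomogeneous_two_mul (isHomogeneous_linForm y)
  | more n h0 h1 =>
    rw [zonal]
    refine IsHomogeneous.sub ?_ ?_
    · have := (isHomogeneous_two_mul (isHomogeneous_linForm y)).mul h1
      rwa [show 1 + (n + 1) = n + 2 by ring] at this
    · have := isHomogeneous_normSqPoly.mul h0
      rwa [add_comm] at this

theorem derivation_two (D : Derivation ℝ (MvPolynomial (Fin 4) ℝ) (MvPolynomial (Fin 4) ℝ)) :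
    D 2 = 0 := D.map_natCast 2

theorem dirDeriv_zonal (hy : ‖y‖ = 1) (n : ℕ) :
    dirDeriv y (zonal y (n + 1)) = (n + 2 : ℕ) * zonal y n := by
  induction n using Nat.twoStepInduction with
  | zero => simp [zonal, derivation_two, dirDeriv_linForm hy]
  | one =>
    simp only [zonal, map_sub, Derivation.leibniz, derivation_two, dirDeriv_linForm hy,
      dirDeriv_normSqPoly, smul_eq_mul, Derivation.map_one_eq_zero]
    push_cast
    ring
  | more n h0 h1 =>
    rw [zonal, map_sub, Derivation.leibniz, Derivation.leibniz, Derivation.leibniz, h0, h1,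
      derivation_two, dirDeriv_linForm hy, dirDeriv_normSqPoly]
    simp only [zonal, smul_eq_mul]
    push_cast
    ring

theorem laplacian_zonal (hy : ‖y‖ = 1) (n : ℕ) : laplacian 4 (zonal y n) = 0 := by
  induction n using Nat.twoStepInduction with
  | zero => simp [zonal, laplacian_apply]
  | one =>
    simp [zonal, laplacian_apply, pderiv_linForm, derivation_two]
  | more n h0 h1 =>
    -- Dimension four enters here: both products in the recursion contribute `4 * (n + 2) * zonal y
    -- n`, and they cancel.
    rw [zonal, map_sub, mul_assoc, show (2 : MvPolynomial (Fin 4) ℝ) = C 2 from rfl, C_mul',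
      map_smul, laplacian_linForm_mul, laplacian_normSqPoly_mul (isHomogeneous_zonal y n), h0, h1,
      dirDeriv_zonal hy, ← C_mul', show (C 2 : MvPolynomial (Fin 4) ℝ) = 2 from rfl]
    push_cast
    ring

theorem zonal_mem_harm (hy : ‖y‖ = 1) (n : ℕ) : zonal y n ∈ Harm 4 n :=
  ⟨isHomogeneous_zonal y n, laplacian_zonal hy n⟩

theorem eval_zonal (hx : ‖x‖ = 1) (n : ℕ) :
    eval (fun a => x a) (zonal y n) = chebU ⟪x, y⟫ n := by
  induction n using Nat.twoStepInduction with
  | zero => simp [zonal, chebU]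
  | one => simp [zonal, chebU, eval_linForm]
  | more n h0 h1 =>
    simp [zonal, chebU, eval_linForm, eval_normSqPoly, h0, h1, hx]

theorem exists_zonal_eq (y : EuclideanSpace ℝ (Fin 4)) (n : ℕ) :
    ∃ R, zonal y n = (2 : ℝ) ^ n • linForm y ^ n + normSqPoly 4 * R := by
  induction n using Nat.twoStepInduction with
  | zero => exact ⟨0, by simp [zonal]⟩
  | one => exact ⟨0, by simp [zonal, ← C_mul', show (C 2 : MvPolynomial (Fin 4) ℝ) = 2 from rfl]⟩
  | more n h0 h1 =>
    obtain ⟨R, hR⟩ := h1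
    refine ⟨2 * linForm y * R - zonal y n, ?_⟩
    rw [zonal, hR, ← C_mul', ← C_mul', pow_succ (2 : ℝ) (n + 1), C_mul,
      show (C 2 : MvPolynomial (Fin 4) ℝ) = 2 from rfl]
    ring

/-- Modulo `normSqPoly`, `zonal x n` is `2 ^ n` times a power of a linear form. The multiple of
`normSqPoly` pairs to zero with a harmonic polynomial, and the power evaluates it at `x`. -/
theorem fischer_zonal (hx : ‖x‖ = 1) (hy : ‖y‖ = 1) (n : ℕ) :
    fischer (zonal x n) (zonal y n) = 2 ^ n * n.factorial * chebU ⟪x, y⟫ n := by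
  obtain ⟨R, hR⟩ := exists_zonal_eq x n
  rw [hR, map_add, LinearMap.add_apply, fischer_normSqPoly_mul, laplacian_zonal hy, map_zero,
    add_zero, map_smul, LinearMap.smul_apply, fischer_linForm_pow x (isHomogeneous_zonal y n),
    eval_zonal hx, smul_eq_mul, mul_assoc]

/-- Positive definiteness of the Chebyshev polynomials of the second kind on the unit sphere
of `ℝ⁴`. -/
theorem sum_sum_chebU_nonneg (X : Finset (EuclideanSpace ℝ (Fin 4))) (hX : ∀ x ∈ X, ‖x‖ = 1)
    (n : ℕ) : 0 ≤ ∑ x ∈ X, ∑ y ∈ X, chebU ⟪x, y⟫ n := by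
  have h : fischer (∑ x ∈ X, zonal x n) (∑ x ∈ X, zonal x n) =
      2 ^ n * n.factorial * ∑ x ∈ X, ∑ y ∈ X, chebU ⟪x, y⟫ n := by
    simp only [map_sum, LinearMap.sum_apply, Finset.mul_sum]
    rw [Finset.sum_comm]
    exact Finset.sum_congr rfl fun x hx => Finset.sum_congr rfl fun y hy =>
      fischer_zonal (hX x hx) (hX y hy) n
  have h0 := fischer_self_nonneg (∑ x ∈ X, zonal x n)
  rw [h] at h0
  exact nonneg_of_mul_nonneg_right h0 (by positivity)

end ZonalFour

/-! ### Explicit Chebyshev polynomials of even degree. -/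

section ChebU

theorem chebU_two (t : ℝ) : chebU t 2 = 4 * t ^ 2 - 1 := by
  simp only [chebU]; ring

theorem chebU_add_four (t : ℝ) (n : ℕ) :
    chebU t (n + 4) = (4 * t ^ 2 - 2) * chebU t (n + 2) - chebU t n := by
  simp only [chebU]; ring

theorem chebU_four (t : ℝ) : chebU t 4 = 16 * t ^ 4 - 12 * t ^ 2 + 1 := by
  rw [chebU_add_four t 0, chebU_two]; simp only [chebU]; ring

theorem chebU_six (t : ℝ) : chebU t 6 = 64 * t ^ 6 - 80 * t ^ 4 + 24 * t ^ 2 - 1 := by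
  rw [chebU_add_four t 2, chebU_four, chebU_two]; ring

theorem chebU_eight (t : ℝ) :
    chebU t 8 = 256 * t ^ 8 - 448 * t ^ 6 + 240 * t ^ 4 - 40 * t ^ 2 + 1 := by
  rw [chebU_add_four t 4, chebU_six, chebU_four]; ring

theorem chebU_ten (t : ℝ) :
    chebU t 10 = (4 * t ^ 2 - 2) * chebU t 8 - chebU t 6 :=
  chebU_add_four t 6

theorem chebU_fourteen (t : ℝ) :
    chebU t 14 = (4 * t ^ 2 - 2) * ((4 * t ^ 2 - 2) * chebU t 10 - chebU t 8) - chebU t 10 := by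
  rw [chebU_add_four t 10, chebU_add_four t 8]

theorem chebU_sixteen (t : ℝ) :
    chebU t 16 = (4 * t ^ 2 - 2) * chebU t 14 - ((4 * t ^ 2 - 2) * chebU t 10 - chebU t 8) := by
  rw [chebU_add_four t 12, chebU_add_four t 8]

end ChebU

/-! ### Linear programming for antipodal designs. -/

section Designs

variable {X : Finset (EuclideanSpace ℝ (Fin 4))} {T : Set ℕ}

theorem IsSphericalDesign.norm_eq_one {x : EuclideanSpace ℝ (Fin 4)}
    (hX : IsSphericalDesign T X) (hx : x ∈ X) : ‖x‖ = 1 := by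
  simpa using hX.subset_sphere hx

theorem IsSphericalDesign.sum_chebU (hX : IsSphericalDesign T X) {n : ℕ} (hn : n ∈ T)
    {y : EuclideanSpace ℝ (Fin 4)} (hy : ‖y‖ = 1) : ∑ x ∈ X, chebU ⟪x, y⟫ n = 0 := by
  rw [← (hX.subset_harmonicStrength hn).2 _ (zonal_mem_harm hy n)]
  exact Finset.sum_congr rfl fun x hx => (eval_zonal (hX.norm_eq_one hx) n).symm

theorem IsAntipodal.sum_inner (hA : IsAntipodal X) {y : EuclideanSpace ℝ (Fin 4)} (hy : y ∈ X)
    (hy1 : ‖y‖ = 1) (f : ℝ → ℝ) :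
    ∑ x ∈ X, f ⟪x, y⟫ = f 1 + f (-1) + ∑ x ∈ (X.erase y).erase (-y), f ⟪x, y⟫ := by
  have h1 := inner_self_eq_one hy1
  have hne : -y ≠ y := fun h => by
    have h2 := inner_neg_left (𝕜 := ℝ) y y
    rw [h, h1] at h2
    norm_num at h2
  rw [← Finset.add_sum_erase X _ hy,
    ← Finset.add_sum_erase (X.erase y) _ (Finset.mem_erase.2 ⟨hne, hA y hy⟩), inner_neg_left, h1,
    add_assoc]

/-- If a function vanishes at all inner products of non-antipodal distinct points, then the
cardinality of `X` is determined by its values at `±1` and its mean over `X`. -/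
theorem card_mul_eq_of_innerProducts (hA : IsAntipodal X) (hX : IsSphericalDesign T X) {c : ℝ}
    {f : ℝ → ℝ} (hf : ∀ y, ‖y‖ = 1 → ∑ x ∈ X, f ⟪x, y⟫ = X.card * c)
    (h0 : ∀ t ∈ innerProducts X, t ≠ -1 → f t = 0) : X.card * c = f 1 + f (-1) := by
  obtain ⟨y, hy⟩ := hX.nonempty
  have hy1 := hX.norm_eq_one hy
  rw [← hf y hy1, hA.sum_inner hy hy1, Finset.sum_eq_zero, add_zero]
  intro x hx
  simp only [Finset.mem_erase] at hx
  refine h0 _ ⟨x, hx.2.2, y, hy, hx.2.1, rfl⟩ fun h => hx.1 ?_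
  exact (inner_eq_neg_one_iff_of_norm_eq_one (hX.norm_eq_one hx.2.2) hy1).1 h

/-- The equality case of the linear programming bound for antipodal sets. -/
theorem eq_zero_of_mem_innerProducts (hA : IsAntipodal X) (hX : ∀ x ∈ X, ‖x‖ = 1)
    {f : ℝ → ℝ} (hf : ∀ t, |t| ≤ 1 → 0 ≤ f t)
    (hsum : ∑ y ∈ X, ∑ x ∈ X, f ⟪x, y⟫ ≤ X.card * (f 1 + f (-1)))
    {t : ℝ} (ht : t ∈ innerProducts X) (ht1 : t ≠ -1) : f t = 0 := by
  obtain ⟨x, hx, y, hy, hxy, rfl⟩ := ht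
  have hnn : ∀ y ∈ X, ∀ x ∈ (X.erase y).erase (-y), 0 ≤ f ⟪x, y⟫ := fun y hy x hx => by
    refine hf _ ((abs_real_inner_le_norm x y).trans ?_)
    rw [hX y hy, hX x (Finset.mem_of_mem_erase (Finset.mem_of_mem_erase hx)), one_mul]
  -- Removing the terms `x = ±y` leaves nonnegative terms with total at most zero, so each vanishes.
  rw [Finset.sum_congr rfl fun y hy => hA.sum_inner hy (hX y hy) f, Finset.sum_add_distrib,
    Finset.sum_const, nsmul_eq_mul, add_le_iff_nonpos_right] at hsum
  have h := (Finset.sum_eq_zero_iff_of_nonneg fun y hy => Finset.sum_nonneg (hnn y hy)).1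
    (hsum.antisymm (Finset.sum_nonneg fun y hy => Finset.sum_nonneg (hnn y hy))) y hy
  refine (Finset.sum_eq_zero_iff_of_nonneg (hnn y hy)).1 h x ?_
  simp only [Finset.mem_erase]
  refine ⟨?_, hxy, hx⟩
  rintro rfl
  exact ht1 (by rw [inner_neg_left, inner_self_eq_one (hX y hy)])

/-- A version of the equality case in which the sum over each row is known. -/
theorem eq_zero_of_sum_eq (hA : IsAntipodal X) (hX : IsSphericalDesign T X) {c : ℝ}
    {f : ℝ → ℝ} (hf : ∀ y, ‖y‖ = 1 → ∑ x ∈ X, f ⟪x, y⟫ = X.card * c)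
    (hf0 : ∀ t, |t| ≤ 1 → 0 ≤ f t) (hc : X.card * c = f 1 + f (-1))
    {t : ℝ} (ht : t ∈ innerProducts X) (ht1 : t ≠ -1) : f t = 0 := by
  refine eq_zero_of_mem_innerProducts hA (fun x hx => hX.norm_eq_one hx) hf0 (le_of_eq ?_) ht ht1
  rw [Finset.sum_congr rfl fun y hy => hf y (hX.norm_eq_one hy), Finset.sum_const, nsmul_eq_mul,
    hc]

theorem card_eq_twentyFour_iff (hA : IsAntipodal X) (hX : IsSphericalDesign {10, 4, 2} X) :
    X.card = 24 ↔ innerProducts X ⊆ {-1, 1 / 2, -(1 / 2), 0} := by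
  -- Double zeros at the allowed values; the last factor is positive and is chosen to remove `U_8`
  -- and `U_6`.
  set f : ℝ → ℝ := fun t =>
    1024 * (t ^ 2 * (t ^ 2 - 1 / 4) ^ 2 * (t ^ 4 - 7 / 4 * t ^ 2 + 13 / 16)) with hfdef
  have hU : ∀ t, f t = chebU t 10 + 2 * chebU t 4 + 4 * chebU t 2 + 3 := fun t => by
    simp only [hfdef, chebU_ten, chebU_eight, chebU_six, chebU_four, chebU_two]; ring
  have hf : ∀ y, ‖y‖ = 1 → ∑ x ∈ X, f ⟪x, y⟫ = X.card * 3 := fun y hy => by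
    simp only [hU, Finset.sum_add_distrib, ← Finset.mul_sum]
    rw [hX.sum_chebU (by simp) hy, hX.sum_chebU (by simp) hy, hX.sum_chebU (by simp) hy]
    simp
  have hf1 : f 1 + f (-1) = 72 := by norm_num [hfdef]
  constructor
  · intro hc t ht
    by_cases ht1 : t = -1
    · simp [ht1]
    have h := eq_zero_of_sum_eq hA hX hf (fun t _ => by
      have : 0 ≤ t ^ 4 - 7 / 4 * t ^ 2 + 13 / 16 := by nlinarith [sq_nonneg (t ^ 2 - 7 / 8)]
      positivity) (by rw [hf1, hc]; norm_num) ht ht1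
    have h2 : t ^ 4 - 7 / 4 * t ^ 2 + 13 / 16 ≠ 0 := by nlinarith [sq_nonneg (t ^ 2 - 7 / 8)]
    have h3 : t * (t - 1 / 2) * (t + 1 / 2) = 0 := by
      simp only [hfdef, mul_eq_zero, h2, pow_eq_zero_iff, ne_eq, OfNat.ofNat_ne_zero,
        not_false_eq_true, false_or, or_false] at h
      rcases h with h | h
      · simp [h]
      · linear_combination t * h
    simp only [mul_eq_zero, sub_eq_zero, add_eq_zero_iff_eq_neg] at h3
    simp only [Set.mem_insert_iff, Set.mem_singleton_iff]
    tauto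
  · intro h
    have := card_mul_eq_of_innerProducts hA hX hf fun t ht ht1 => by
      rcases h ht with h | h | h | h
      · exact absurd h ht1
      all_goals rw [h]; norm_num [hfdef]
    rw [hf1] at this
    exact_mod_cast (by linarith : (X.card : ℝ) = 24)

theorem card_eq_fortyEight_iff (hA : IsAntipodal X)
    (hX : IsSphericalDesign {14, 10, 6, 4, 2} X) :
    X.card = 48 ↔ innerProducts X ⊆ {-1, 1 / √2, -(1 / √2), 1 / 2, -(1 / 2), 0} := by
  have hs : (1 / √2) ^ 2 = 1 / 2 := by rw [div_pow, Real.sq_sqrt zero_le_two, one_pow]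
  -- Same design: the last factor removes `U_12` and `U_8`.
  set f : ℝ → ℝ := fun t => 49152 * (t ^ 2 * (t ^ 2 - 1 / 4) ^ 2 * (t ^ 2 - 1 / 2) ^ 2 *
    (t ^ 4 - 7 / 4 * t ^ 2 + 37 / 48)) with hfdef
  have hU : ∀ t, f t = 3 * chebU t 14 + 4 * chebU t 10 + 3 * chebU t 6 + 5 * chebU t 4 +
      chebU t 2 + 6 := fun t => by
    simp only [hfdef, chebU_fourteen, chebU_ten, chebU_eight, chebU_six, chebU_four, chebU_two]
    ring
  have hf : ∀ y, ‖y‖ = 1 → ∑ x ∈ X, f ⟪x, y⟫ = X.card * 6 := fun y hy => by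
    simp only [hU, Finset.sum_add_distrib, ← Finset.mul_sum]
    rw [hX.sum_chebU (by simp) hy, hX.sum_chebU (by simp) hy, hX.sum_chebU (by simp) hy,
      hX.sum_chebU (by simp) hy, hX.sum_chebU (by simp) hy]
    simp
  have hf1 : f 1 + f (-1) = 288 := by norm_num [hfdef]
  constructor
  · intro hc t ht
    by_cases ht1 : t = -1
    · simp [ht1]
    have h := eq_zero_of_sum_eq hA hX hf (fun t _ => by
      have : 0 ≤ t ^ 4 - 7 / 4 * t ^ 2 + 37 / 48 := by nlinarith [sq_nonneg (t ^ 2 - 7 / 8)]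
      positivity) (by rw [hf1, hc]; norm_num) ht ht1
    have h2 : t ^ 4 - 7 / 4 * t ^ 2 + 37 / 48 ≠ 0 := by nlinarith [sq_nonneg (t ^ 2 - 7 / 8)]
    have h3 : t * (t - 1 / 2) * (t + 1 / 2) * (t - 1 / √2) * (t + 1 / √2) = 0 := by
      simp only [hfdef, mul_eq_zero, h2, pow_eq_zero_iff, ne_eq, OfNat.ofNat_ne_zero,
        not_false_eq_true, false_or, or_false] at h
      rcases h with (h | h) | h
      · simp [h]
      · linear_combination t * (t - 1 / √2) * (t + 1 / √2) * h
      · linear_combination t * (t ^ 2 - 1 / 4) * (h - hs)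
    simp only [mul_eq_zero, sub_eq_zero, add_eq_zero_iff_eq_neg] at h3
    simp only [Set.mem_insert_iff, Set.mem_singleton_iff]
    tauto
  · intro h
    have := card_mul_eq_of_innerProducts hA hX hf fun t ht ht1 => by
      rcases h ht with h | h | h | h | h | h
      · exact absurd h ht1
      all_goals rw [h]; simp only [hfdef, neg_sq, hs]; norm_num
    rw [hf1] at this
    exact_mod_cast (by linarith : (X.card : ℝ) = 48)

theorem card_eq_oneHundredTwenty_of_innerProducts (hA : IsAntipodal X)
    (hX : IsSphericalDesign {10, 8, 6, 4, 2} X)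
    (h : ∀ t ∈ innerProducts X, t ≠ -1 →
      t * (t ^ 2 - 1 / 4) * (t ^ 4 - 3 / 4 * t ^ 2 + 1 / 16) = 0) : X.card = 120 := by
  -- No sign is needed in this direction, so simple zeros suffice; the extra `t` makes `f` even.
  set f : ℝ → ℝ := fun t =>
    256 * t * (t * (t ^ 2 - 1 / 4) * (t ^ 4 - 3 / 4 * t ^ 2 + 1 / 16)) with hfdef
  have hU : ∀ t, f t = chebU t 8 + 3 * chebU t 6 + 4 * chebU t 4 + 3 * chebU t 2 + 1 :=
    fun t => by
      simp only [hfdef, chebU_eight, chebU_six, chebU_four, chebU_two]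
      ring
  have hf : ∀ y, ‖y‖ = 1 → ∑ x ∈ X, f ⟪x, y⟫ = X.card * 1 := fun y hy => by
    simp only [hU, Finset.sum_add_distrib, ← Finset.mul_sum]
    rw [hX.sum_chebU (by simp) hy, hX.sum_chebU (by simp) hy, hX.sum_chebU (by simp) hy,
      hX.sum_chebU (by simp) hy]
    simp
  have := card_mul_eq_of_innerProducts hA hX hf fun t ht ht1 => by
    rw [hfdef]; simp only [h t ht ht1, mul_zero]
  have hf1 : f 1 + f (-1) = 120 := by norm_num [hfdef]
  rw [hf1, mul_one] at this
  exact_mod_cast this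

theorem innerProducts_of_card_eq_oneHundredTwenty (hA : IsAntipodal X)
    (hX : IsSphericalDesign {10, 8, 6, 4, 2} X) (hc : X.card = 120) {t : ℝ}
    (ht : t ∈ innerProducts X) (ht1 : t ≠ -1) :
    t * (t ^ 2 - 1 / 4) * (t ^ 4 - 3 / 4 * t ^ 2 + 1 / 16) = 0 := by
  -- The constant `6 / 5` is the one that removes `U_12`, and it keeps the last factor positive on
  -- `[-1, 1]`.
  set f : ℝ → ℝ := fun t => 327680 *
    ((t * (t ^ 2 - 1 / 4) * (t ^ 4 - 3 / 4 * t ^ 2 + 1 / 16)) ^ 2 * (6 / 5 - t ^ 2)) with hfdef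
  have hU : ∀ t, f t + 5 * chebU t 16 + 11 * chebU t 14 = 42 * chebU t 10 + 102 * chebU t 8 +
      154 * chebU t 6 + 177 * chebU t 4 + 149 * chebU t 2 + 60 := fun t => by
    simp only [hfdef, chebU_sixteen, chebU_fourteen, chebU_ten, chebU_eight, chebU_six, chebU_four,
      chebU_two]
    ring
  have hf : ∀ y, ‖y‖ = 1 → ∑ x ∈ X, (f ⟪x, y⟫ + 5 * chebU ⟪x, y⟫ 16 + 11 * chebU ⟪x, y⟫ 14) =
      120 * 60 := fun y hy => by
    simp only [hU]
    simp only [Finset.sum_add_distrib, ← Finset.mul_sum]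
    rw [hX.sum_chebU (by simp) hy, hX.sum_chebU (by simp) hy, hX.sum_chebU (by simp) hy,
      hX.sum_chebU (by simp) hy, hX.sum_chebU (by simp) hy]
    simp [hc]
  have hlt : ∀ {t : ℝ}, |t| ≤ 1 → 0 < 6 / 5 - t ^ 2 := fun {t} h => by
    have := (sq_le_one_iff_abs_le_one t).2 h
    linarith
  have hnorm : ∀ x ∈ X, ‖x‖ = 1 := fun x hx => hX.norm_eq_one hx
  have h := eq_zero_of_mem_innerProducts hA hnorm (f := f)
    (fun t h => by have := hlt h; positivity) (by
      have h1 := Finset.sum_congr (rfl : X = X) fun y hy => hf y (hnorm y hy)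
      -- Dropping these nonnegative double sums turns the identity for `f` into the required upper
      -- bound.
      have h14 := sum_sum_chebU_nonneg X hnorm 14
      have h16 := sum_sum_chebU_nonneg X hnorm 16
      rw [Finset.sum_comm] at h14 h16
      simp only [Finset.sum_add_distrib, ← Finset.mul_sum, Finset.sum_const, nsmul_eq_mul] at h1
      have hf1 : f 1 + f (-1) = 120 * 60 / 1 := by norm_num [hfdef]
      rw [hf1]
      linarith) ht ht1
  have habs : |t| ≤ 1 := by
    obtain ⟨x, hx, y, hy, -, rfl⟩ := ht
    simpa [hnorm x hx, hnorm y hy] using abs_real_inner_le_norm x y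
  simpa [hfdef, (hlt habs).ne'] using h

/-- The golden ratio and its conjugate have sum `1` and product `-1`, so their squares are the roots
of `s ^ 2 - 3 * s + 1`; put `s = 4 * t ^ 2`. -/
theorem quartic_eq_zero_iff (t : ℝ) : t ^ 4 - 3 / 4 * t ^ 2 + 1 / 16 = 0 ↔
    t = Real.goldenRatio⁻¹ / 2 ∨ t = -(Real.goldenRatio⁻¹ / 2) ∨
      t = Real.goldenRatio / 2 ∨ t = -(Real.goldenRatio / 2) := by
  have hm := Real.goldenRatio_mul_goldenConj
  have ha := Real.goldenRatio_add_goldenConj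
  rw [Real.inv_goldenRatio]
  have h : t ^ 4 - 3 / 4 * t ^ 2 + 1 / 16 =
      (t - -Real.goldenConj / 2) * (t - -(-Real.goldenConj / 2)) *
        (t - Real.goldenRatio / 2) * (t - -(Real.goldenRatio / 2)) := by
    generalize Real.goldenRatio = a at *
    generalize Real.goldenConj = b at *
    linear_combination t ^ 2 / 4 * ((a + b + 1) * ha - 2 * hm) - (a * b - 1) / 16 * hm
  rw [h]
  simp only [mul_eq_zero, sub_eq_zero, or_assoc]

theorem card_eq_oneHundredTwenty_iff (hA : IsAntipodal X)
    (hX : IsSphericalDesign {10, 8, 6, 4, 2} X) :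
    X.card = 120 ↔ innerProducts X ⊆ {-1, Real.goldenRatio⁻¹ / 2, -(Real.goldenRatio⁻¹ / 2),
      Real.goldenRatio / 2, -(Real.goldenRatio / 2), 1 / 2, -(1 / 2), 0} := by
  have key : ∀ t : ℝ, t * (t ^ 2 - 1 / 4) * (t ^ 4 - 3 / 4 * t ^ 2 + 1 / 16) = 0 ↔
      t = Real.goldenRatio⁻¹ / 2 ∨ t = -(Real.goldenRatio⁻¹ / 2) ∨ t = Real.goldenRatio / 2 ∨
        t = -(Real.goldenRatio / 2) ∨ t = 1 / 2 ∨ t = -(1 / 2) ∨ t = 0 := fun t => by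
    have h : t ^ 2 - 1 / 4 = (t - 1 / 2) * (t - -(1 / 2)) := by ring
    rw [mul_eq_zero, quartic_eq_zero_iff, mul_eq_zero, h, mul_eq_zero, sub_eq_zero, sub_eq_zero]
    tauto
  constructor
  · intro hc t ht
    by_cases ht1 : t = -1
    · exact Or.inl ht1
    · exact Or.inr ((key t).1 (innerProducts_of_card_eq_oneHundredTwenty hA hX hc ht ht1))
  · exact fun h => card_eq_oneHundredTwenty_of_innerProducts hA hX fun t ht ht1 =>
      (key t).2 ((h ht).resolve_left ht1)

end Designs

end SphericalDesign

theorem mainTheorem5 :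
    (∀ X : Finset (EuclideanSpace ℝ (Fin 4)),
      SphericalDesign.IsAntipodal X →
      SphericalDesign.IsSphericalDesign {10, 4, 2} X →
      (X.card = 24 ↔
        SphericalDesign.innerProducts X ⊆ {-1, 1 / 2, -(1 / 2), 0})) ∧
    (∀ X : Finset (EuclideanSpace ℝ (Fin 4)),
      SphericalDesign.IsAntipodal X →
      SphericalDesign.IsSphericalDesign {14, 10, 6, 4, 2} X →
      (X.card = 48 ↔
        SphericalDesign.innerProducts X ⊆
          {-1, 1 / √2, -(1 / √2), 1 / 2, -(1 / 2), 0})) ∧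
    (∀ X : Finset (EuclideanSpace ℝ (Fin 4)),
      SphericalDesign.IsAntipodal X →
      SphericalDesign.IsSphericalDesign {10, 8, 6, 4, 2} X →
      (X.card = 120 ↔
        SphericalDesign.innerProducts X ⊆
          {-1, Real.goldenRatio⁻¹ / 2, -(Real.goldenRatio⁻¹ / 2),
            Real.goldenRatio / 2, -(Real.goldenRatio / 2), 1 / 2, -(1 / 2), 0})) :=
  ⟨fun _ hA hX => SphericalDesign.card_eq_twentyFour_iff hA hX,
    fun _ hA hX => SphericalDesign.card_eq_fortyEight_iff hA hX,
    fun _ hA hX => SphericalDesign.card_eq_oneHundredTwenty_iff hA hX⟩
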